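/- Consider the deterministic synchronous message-passing model: the network is an $n$-vertex simple undirected graph $G$, its vertices carry distinct identity numbers from $\{1,\dots,n\}$, and each vertex initially knows $n$, an integer $a \ge 1$ and its own identity number. In each round every running vertex may send a message to each of its neighbors, and then updates its state according to the messages it received; message length and local computation are unrestricted. The running time is the number of rounds until all vertices have halted, each with a color. The arboricity of $G$ is the least number of edge-disjoint forests that cover its edge set, and $\log$ is to base $2$. **Theorem.** Let $\eta > 0$ be a constant and let $g:\mathbb{N}\to\mathbb{R}$ be a function with $g(a)\to\infty$ and $g(a) = O(a^{1-\eta})$ as $a\to\infty$. Then there are a deterministic distributed algorithm and a constant $C>0$ (depending only on $\eta$ and $g$) such that, for every integer $a \ge 1$ with $g(a) > 1$, every $n$, every $n$-vertex graph $G$ of arboricity at most $a$, and every assignment of distinct identity numbers from $\{1,\dots,n\}$ to its vertices, the algorithm computes a legal coloring of $G$ (adjacent vertices get different colors) with at most $C\cdot a^2/g(a)$ colors, within at most $C\cdot\log g(a)\cdot\log n$ rounds. -/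

import Mathlib

open Filter Asymptotics

/-- `F` is a decomposition of the edge set of `G` into `k` pairwise edge-disjoint forests
(some of them may have no edges). -/
def IsForestsDecomposition {V : Type*} (G : SimpleGraph V) (k : ℕ)
    (F : Fin k → SimpleGraph V) : Prop :=
  (∀ i, (F i).IsAcyclic) ∧ Pairwise (fun i j => Disjoint (F i) (F j)) ∧ ⨆ i, F i = G

/-- The arboricity of a (finite) graph: the least number of edge-disjoint forests that cover
its edge set. -/
noncomputable def arboricity {V : Type*} (G : SimpleGraph V) : ℕ :=
  sInf {k | ∃ F : Fin k → SimpleGraph V, IsForestsDecomposition G k F}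

/-- On a finite vertex set the infimum in `arboricity` is attained. -/
theorem exists_isForestsDecomposition_arboricity {V : Type*} [Finite V] (G : SimpleGraph V) :
    ∃ F : Fin (arboricity G) → SimpleGraph V,
      IsForestsDecomposition G (arboricity G) F := by
  have hne : {k | ∃ F : Fin k → SimpleGraph V, IsForestsDecomposition G k F}.Nonempty := by
    obtain ⟨m, ⟨e⟩⟩ := Finite.exists_equiv_fin G.edgeSet
    refine ⟨m, fun i => SimpleGraph.fromEdgeSet {(e.symm i : Sym2 V)}, ?_, ?_, ?_⟩
    · intro i
      rw [SimpleGraph.isAcyclic_iff_forall_adj_isBridge]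
      intro u v huv
      rw [SimpleGraph.isBridge_iff]
      have h := huv
      rw [SimpleGraph.fromEdgeSet_adj, Set.mem_singleton_iff] at h
      have hbot : (SimpleGraph.fromEdgeSet {(e.symm i : Sym2 V)}).deleteEdges {s(u, v)} = ⊥ := by
        rw [← h.1, SimpleGraph.deleteEdges, sdiff_self]
      change ¬ ((SimpleGraph.fromEdgeSet {(e.symm i : Sym2 V)}).deleteEdges {s(u, v)}).Reachable u v
      rw [hbot, SimpleGraph.reachable_bot]
      exact h.2
    · intro i j hij
      rw [← SimpleGraph.disjoint_edgeSet, Set.disjoint_left]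
      intro x hx hy
      rw [SimpleGraph.edgeSet_fromEdgeSet] at hx hy
      have hxi : x = (e.symm i : Sym2 V) := hx.1
      have hyj : x = (e.symm j : Sym2 V) := hy.1
      exact hij (e.symm.injective (Subtype.ext (hxi.symm.trans hyj)))
    · ext u v
      simp only [SimpleGraph.iSup_adj, SimpleGraph.fromEdgeSet_adj, Set.mem_singleton_iff]
      constructor
      · rintro ⟨i, h, -⟩
        have := (e.symm i).2
        rw [← h] at this
        exact this
      · intro h
        exact ⟨e ⟨s(u, v), h⟩, by simp, h.ne⟩
  exact Nat.sInf_mem hne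

/-- A deterministic synchronous message-passing algorithm that outputs colors.  Message length and
local computation are unrestricted.  A vertex starts with the number `n` of vertices, the
arboricity bound `a` and its own identity number, and nothing else about the graph. -/
structure LocalAlgorithm where
  /-- local states of a vertex -/
  State : Type
  /-- messages -/
  Msg : Type
  /-- `init n a i` is the initial state of the vertex with identity number `i` -/
  init : ℕ → ℕ → ℕ → State
  /-- `send s j` is the message sent, in state `s`, to the neighbor (if there is one) with
  identity number `j` -/
  send : State → ℕ → Msg
  /-- the new state, from the old one and the received messages, each with the identity number of
  its sender -/
  recv : State → Set (ℕ × Msg) → State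
  /-- `some c` if the vertex has halted with final color `c`, and `none` if it is still running -/
  out : State → Option ℕ

namespace LocalAlgorithm

/-- The state of each vertex after `t` rounds.  In a round, every running vertex sends
a message to each of its neighbors, and then every running vertex updates its state according to
the messages it has received.  Halted vertices send nothing and never change. -/
def stateAfter (A : LocalAlgorithm) {V : Type*} (G : SimpleGraph V) (ident : V → ℕ) (n a : ℕ) :
    ℕ → V → A.State
  | 0, v => A.init n a (ident v)
  | t + 1, v =>
    let s := A.stateAfter G ident n a t
    if (A.out (s v)).isSome then s v
    else A.recv (s v)
      {p | ∃ u, G.Adj v u ∧ A.out (s u) = none ∧ p = (ident u, A.send (s u) (ident v))}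

/-- Run on `G` with the identity numbers `ident` and the parameter `a`, all vertices have
halted after at most `T` rounds, and their colors form a legal coloring with `k` colors. -/
def ColorsWithin (A : LocalAlgorithm) {V : Type*} [Fintype V] (G : SimpleGraph V)
    (ident : V → ℕ) (a k T : ℕ) : Prop :=
  ∃ c : G.Coloring (Fin k),
    ∀ v, A.out (A.stateAfter G ident (Fintype.card V) a T v) = some (c v : ℕ)

end LocalAlgorithm

/-! The proof trades colors for out-degree. Suppose that the edges inside color classes can be
oriented with out-degrees at most β. For fixed m, one phase of O(log n) rounds splits each class
into 2^m classes with bound β/2^(m-3). At the start there is one class with bound a: orient each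
forest toward its roots. After r phases, each of the 2^(mr) classes is legally colored with O(β²)
colors, β = a/2^((m-3)r), for O(a²/2^((m-6)r)) colors in all. Taking m = e + 6 and r = ⌊log g(a) /
e⌋ gives O(a²/g(a)). The bound β must not fall far below 1, and here g(a) = O(a^(1-η)) enters:
2^((e+3)r) = O(a) once e is large in terms of η.

A phase is analysed in `run_phaseProg`. Peeling off vertices of small degree gives O(log n) layers
in which a vertex has at most A = 4β classmates among its neighbors in the same or higher layers
(`run_layerProg`). Edges point to higher layers, ties going to the larger identity. Recoloring by
polynomials then yields O(4^m) auxiliary colors, with at most A/2^m out-neighbors of a vertex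
sharing its color (`run_refineProg`). Layer and auxiliary color define O(log n) time slots. From the
last slot down, each vertex picks one of 2^m colors that at most A/2^m neighbors in its class and
later slots have (`run_greedyRounds`). Conflicts with later slots and within a slot add up to at
most 2A/2^m = β/2^(m-3). The final coloring (`run_finalProg`) is the polynomial recoloring with the
permitted number of conflicts pushed below one. -/

/-! ### Orientations, averaging and polynomials over prime fields -/

section Combinatorics

open Classical in
/-- The edges of `G` with monochromatic ends under `c` have an orientation in which all
out-degrees are at most `β`. -/
def OutDegreeBound {V : Type*} [Fintype V] (G : SimpleGraph V) (c : V → ℕ) (β : ℕ) : Prop :=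
  ∃ R : V → V → Prop, (∀ u v, G.Adj u v → c u = c v → R u v ∨ R v u) ∧
    ∀ v, (Finset.univ.filter fun u => R v u).card ≤ β

/-- A forest has an orientation in which all out-degrees are at most one. -/
theorem SimpleGraph.IsAcyclic.exists_parent {V : Type*} {F : SimpleGraph V} (hF : F.IsAcyclic) :
    ∃ f : V → V, ∀ u v, F.Adj u v → f u = v ∨ f v = u := by
  have hreach : ∀ v, F.Reachable v (F.connectedComponentMk v).out := fun v =>
    SimpleGraph.ConnectedComponent.exact (Quot.out_eq (F.connectedComponentMk v)).symm
  choose p hp using fun v => (hreach v).exists_isPath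
  refine ⟨fun v => (p v).snd, fun u v huv => ?_⟩
  have hc : F.connectedComponentMk u = F.connectedComponentMk v :=
    SimpleGraph.ConnectedComponent.sound huv.reachable
  have hroot : (F.connectedComponentMk u).out = (F.connectedComponentMk v).out := by rw [hc]
  -- The parent is the next vertex on the path to the root. If `v` is not on the path of `u`,
  -- prepending it gives the unique path from `v`, whose second vertex is `u`.
  by_cases hv : v ∈ (p u).support
  · exact Or.inl (hF.eq_snd_of_adj_start (hp u) huv hv).symm
  · right
    have hq : (SimpleGraph.Walk.cons huv.symm (p u)).IsPath :=
      (SimpleGraph.Walk.cons_isPath_iff _ _).2 ⟨hp u, hv⟩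
    have hq' : ((SimpleGraph.Walk.cons huv.symm (p u)).copy rfl hroot).IsPath := by
      simpa using hq
    have h' : (SimpleGraph.Walk.cons huv.symm (p u)).copy rfl hroot = p v :=
      Subtype.mk.inj <| (hF.subsingleton_path _ _).elim ⟨_, hq'⟩ ⟨p v, hp v⟩
    exact (hF.eq_snd_of_adj_start (hp v) huv.symm (by rw [← h']; simp)).symm

/-- Each forest contributes at most one out-neighbor, the parent. -/
theorem OutDegreeBound.of_arboricity_le {V : Type*} [Fintype V] {G : SimpleGraph V} {a : ℕ}
    (h : arboricity G ≤ a) (c : V → ℕ) : OutDegreeBound G c a := by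
  classical
  obtain ⟨F, hF, -, hG⟩ := exists_isForestsDecomposition_arboricity G
  choose f hf using fun i => (hF i).exists_parent
  refine ⟨fun v u => ∃ i, f i v = u, fun u v huv _ => ?_, fun v => le_trans ?_ h⟩
  · rw [← hG, SimpleGraph.iSup_adj] at huv
    obtain ⟨i, hi⟩ := huv
    exact (hf i u v hi).imp (fun h => ⟨i, h⟩) fun h => ⟨i, h⟩
  · have : (Finset.univ.filter fun u => ∃ i, f i v = u) = Finset.univ.image fun i => f i v := by
      ext u; simp
    simp only [this]
    exact Finset.card_image_le.trans (by simp)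

open Classical in
/-- Fewer than half of the vertices of `S` have more than `4 * β` monochromatic neighbors
in `S`. -/
theorem OutDegreeBound.two_mul_card_le {V : Type*} [Fintype V] {G : SimpleGraph V} {c : V → ℕ}
    {β : ℕ} (h : OutDegreeBound G c β) (S : Finset V) :
    2 * (S.filter fun v => 4 * β < (S.filter fun u => G.Adj v u ∧ c u = c v).card).card
      ≤ S.card := by
  obtain ⟨R, hR, hβ⟩ := h
  set T := S.filter fun v => 4 * β < (S.filter fun u => G.Adj v u ∧ c u = c v).card
  -- Out-degrees and in-degrees within `S` have equal sums, so the monochromatic degrees in `S` sum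
  -- to at most 2β|S|, while each vertex of `T` contributes at least 4β + 1.
  have h1 : ∑ v ∈ S, (S.filter fun u => G.Adj v u ∧ c u = c v).card ≤
      ∑ v ∈ S, (S.filter fun u => R v u).card + ∑ v ∈ S, (S.filter fun u => R u v).card := by
    rw [← Finset.sum_add_distrib]
    refine Finset.sum_le_sum fun v _ => le_trans (Finset.card_le_card ?_) (Finset.card_union_le _ _)
    intro u hu
    simp only [Finset.mem_filter, Finset.mem_union] at hu ⊢
    rcases hR v u hu.2.1 hu.2.2.symm with h | h
    · exact Or.inl ⟨hu.1, h⟩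
    · exact Or.inr ⟨hu.1, h⟩
  have h2 : ∑ v ∈ S, (S.filter fun u => R u v).card = ∑ v ∈ S, (S.filter fun u => R v u).card :=
    (Finset.sum_card_bipartiteAbove_eq_sum_card_bipartiteBelow R).symm
  have h3 : ∑ v ∈ S, (S.filter fun u => R v u).card ≤ S.card * β := by
    refine Finset.sum_le_card_nsmul _ _ _ fun v _ => le_trans (Finset.card_le_card ?_) (hβ v)
    exact Finset.filter_subset_filter _ (Finset.subset_univ _)
  have h4 : T.card * (4 * β + 1) ≤
      ∑ v ∈ S, (S.filter fun u => G.Adj v u ∧ c u = c v).card := by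
    refine le_trans ?_ (Finset.sum_le_sum_of_subset (Finset.filter_subset _ _ : T ⊆ S))
    rw [← smul_eq_mul]
    exact Finset.card_nsmul_le_sum T _ _ fun v hv => (Finset.mem_filter.1 hv).2
  have h5 : T.card ≤ S.card := Finset.card_filter_le _ _
  rcases Nat.eq_zero_or_pos β with rfl | hpos
  · omega
  · by_contra hlt
    push Not at hlt
    nlinarith

theorem exists_mul_le_sum {p : ℕ} (hp : 0 < p) (f : ℕ → ℕ) :
    ∃ x < p, p * f x ≤ ∑ y ∈ Finset.range p, f y := by
  obtain ⟨x, hx, hmin⟩ := Finset.exists_min_image (Finset.range p) f ⟨0, Finset.mem_range.2 hp⟩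
  exact ⟨x, Finset.mem_range.1 hx, by
    simpa using Finset.card_nsmul_le_sum (Finset.range p) f (f x) hmin⟩

open Classical in
/-- An index below `p` at which `f` is at most its average over the indices below `p`. -/
noncomputable def lowIndex (p : ℕ) (f : ℕ → ℕ) : ℕ :=
  if h : 0 < p then (exists_mul_le_sum h f).choose else 0

theorem lowIndex_lt {p : ℕ} (hp : 0 < p) (f : ℕ → ℕ) : lowIndex p f < p := by
  rw [lowIndex, dif_pos hp]; exact (exists_mul_le_sum hp f).choose_spec.1

theorem mul_lowIndex_le {p : ℕ} (hp : 0 < p) (f : ℕ → ℕ) :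
    p * f (lowIndex p f) ≤ ∑ y ∈ Finset.range p, f y := by
  rw [lowIndex, dif_pos hp]; exact (exists_mul_le_sum hp f).choose_spec.2

/-- The value at `x` of the polynomial over `ℤ/p` whose coefficients are the five lowest digits
of `c` in base `p`. -/
def digitEval (p c x : ℕ) : ℕ := (∑ i ∈ Finset.range 5, c / p ^ i % p * x ^ i) % p

theorem eq_of_digits_eq {p : ℕ} : ∀ {D c c' : ℕ}, c < p ^ D → c' < p ^ D →
    (∀ i < D, c / p ^ i % p = c' / p ^ i % p) → c = c' := by
  intro D
  induction D with
  | zero => intro c c' h h' _; simp at h h'; omega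
  | succ D ih =>
    intro c c' h h' hd
    have h1 : c / p = c' / p := by
      refine ih (Nat.div_lt_of_lt_mul (by rwa [pow_succ'] at h))
        (Nat.div_lt_of_lt_mul (by rwa [pow_succ'] at h')) fun i hi => ?_
      have := hd (i + 1) (by omega)
      rwa [pow_succ', ← Nat.div_div_eq_div_mul, ← Nat.div_div_eq_div_mul] at this
    have h2 := hd 0 (by omega)
    simp only [pow_zero, Nat.div_one] at h2
    rw [← Nat.div_add_mod c p, ← Nat.div_add_mod c' p, h1, h2]

/-- Five digits determine a number below `p ^ 5`, so the difference of the two polynomials is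
nonzero of degree at most four and has at most four roots. -/
theorem card_digitEval_eq_le {p : ℕ} (hp : p.Prime) {c c' : ℕ} (hc : c < p ^ 5) (hc' : c' < p ^ 5)
    (hne : c ≠ c') :
    ((Finset.range p).filter fun x => digitEval p c x = digitEval p c' x).card ≤ 4 := by
  classical
  have : Fact p.Prime := ⟨hp⟩
  let P : Polynomial (ZMod p) := ∑ i ∈ Finset.range 5,
    Polynomial.monomial i (((c / p ^ i % p : ℕ) : ZMod p) - ((c' / p ^ i % p : ℕ) : ZMod p))
  have hcoeff : ∀ i < 5, P.coeff i =
      ((c / p ^ i % p : ℕ) : ZMod p) - ((c' / p ^ i % p : ℕ) : ZMod p) := by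
    intro i hi
    simp only [P, Polynomial.finsetSum_coeff, Polynomial.coeff_monomial]
    rw [Finset.sum_ite_eq' (Finset.range 5) i, if_pos (Finset.mem_range.2 hi)]
  have hP : P ≠ 0 := by
    intro h0
    refine hne (eq_of_digits_eq hc hc' fun i hi => ?_)
    have h := hcoeff i hi
    rw [h0, Polynomial.coeff_zero, eq_comm, sub_eq_zero, ZMod.natCast_eq_natCast_iff'] at h
    simpa using h
  have hdeg : P.natDegree ≤ 4 :=
    Polynomial.natDegree_sum_le_of_forall_le _ _ fun i hi =>
      (Polynomial.natDegree_monomial_le _).trans (by have := Finset.mem_range.1 hi; omega)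
  refine le_trans ?_ ((Multiset.toFinset_card_le _).trans ((Polynomial.card_roots' P).trans hdeg))
  refine Finset.card_le_card_of_injOn (fun x => (x : ZMod p)) (fun x hx => ?_) ?_
  · rw [Finset.mem_coe, Finset.mem_filter] at hx
    rw [Finset.mem_coe, Multiset.mem_toFinset, Polynomial.mem_roots hP, Polynomial.IsRoot.def]
    have h := hx.2
    rw [digitEval, digitEval, ← ZMod.natCast_eq_natCast_iff'] at h
    push_cast at h
    simp only [P, Polynomial.eval_finsetSum, Polynomial.eval_monomial, sub_mul,
      Finset.sum_sub_distrib]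
    rw [sub_eq_zero]
    exact h
  · intro x hx y hy hxy
    simp only [Finset.coe_filter, Finset.mem_range, Set.mem_ofPred_eq] at hx hy
    have := (ZMod.natCast_eq_natCast_iff' x y p).1 hxy
    rwa [Nat.mod_eq_of_lt hx.1, Nat.mod_eq_of_lt hy.1] at this

theorem exists_scalePrime (j : ℕ) : ∃ p : ℕ, p.Prime ∧ 2 ^ j < p ∧ p ≤ 2 ^ (j + 1) := by
  obtain ⟨p, hp, h1, h2⟩ := Nat.exists_prime_lt_and_le_two_mul (2 ^ j) (by positivity)
  exact ⟨p, hp, h1, by rwa [pow_succ']⟩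

/-- A prime in the interval `(2 ^ j, 2 ^ (j + 1)]`. -/
noncomputable def scalePrime (j : ℕ) : ℕ := (exists_scalePrime j).choose

theorem scalePrime_prime (j : ℕ) : (scalePrime j).Prime := (exists_scalePrime j).choose_spec.1
theorem lt_scalePrime (j : ℕ) : 2 ^ j < scalePrime j := (exists_scalePrime j).choose_spec.2.1
theorem scalePrime_le (j : ℕ) : scalePrime j ≤ 2 ^ (j + 1) :=
  (exists_scalePrime j).choose_spec.2.2

/-- The colors produced at scale `j + 1` fit into five digits at scale `j`; this needs 2(j + 2) ≤
5j. -/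
theorem scalePrime_succ_sq_le {j : ℕ} (hj : 2 ≤ j) :
    scalePrime (j + 1) ^ 2 ≤ scalePrime j ^ 5 := by
  calc scalePrime (j + 1) ^ 2 ≤ (2 ^ (j + 2)) ^ 2 := Nat.pow_le_pow_left (scalePrime_le _) 2
    _ = 2 ^ ((j + 2) * 2) := by rw [pow_mul]
    _ ≤ 2 ^ (j * 5) := Nat.pow_le_pow_right (by norm_num) (by omega)
    _ = (2 ^ j) ^ 5 := by rw [pow_mul]
    _ ≤ scalePrime j ^ 5 := Nat.pow_le_pow_left (lt_scalePrime j).le 5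

end Combinatorics

/-! ### Lockstep programs as message-passing algorithms -/

section Programs

/-- The registers of a vertex: its identity number, its layer, the color of the auxiliary
defective coloring, the greedily chosen color, and the class to which the vertex belongs. -/
structure VertexData where
  id : ℕ
  lay : ℕ
  psi : ℕ
  kc : ℕ
  cls : ℕ

/-- What a vertex does in a round, from its own data and the data of its neighbors. -/
abbrev Step := VertexData → Set VertexData → VertexData

/-- One synchronous round. -/
def runStep {V : Type*} (G : SimpleGraph V) (s : Step) (x : V → VertexData) : V → VertexData :=
  fun v => s (x v) (x '' {u | G.Adj v u})

/-- Execution of a list of steps, one per round. -/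
def run {V : Type*} (G : SimpleGraph V) (l : List Step) (x : V → VertexData) : V → VertexData :=
  l.foldl (fun y s => runStep G s y) x

@[simp] theorem run_nil {V : Type*} (G : SimpleGraph V) (x : V → VertexData) :
    run G [] x = x := rfl

@[simp] theorem run_cons {V : Type*} (G : SimpleGraph V) (s : Step) (l : List Step)
    (x : V → VertexData) : run G (s :: l) x = run G l (runStep G s x) := rfl

@[simp] theorem run_append {V : Type*} (G : SimpleGraph V) (l l' : List Step)
    (x : V → VertexData) : run G (l ++ l') x = run G l' (run G l x) := by
  simp [run, List.foldl_append]

/-- The algorithm in which all vertices execute in lockstep a program that depends only on the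
number of vertices and the arboricity bound, and then return their class. -/
def programAlgorithm (prog : ℕ → ℕ → List Step) : LocalAlgorithm where
  State := List Step × VertexData
  Msg := VertexData
  init n a i := (prog n a, ⟨i, 0, 0, 0, 0⟩)
  send s _ := s.2
  recv s M := (s.1.tail, (s.1.headD fun d _ => d) s.2 (Prod.snd '' M))
  out s := if s.1.isEmpty then some s.2.cls else none

/-- The data at the start of an execution. -/
def initialData {V : Type*} (ident : V → ℕ) : V → VertexData := fun v => ⟨ident v, 0, 0, 0, 0⟩

/-- The remaining programs of all vertices coincide, so none halts early and every neighbor's data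
arrives in every round. -/
theorem stateAfter_programAlgorithm (prog : ℕ → ℕ → List Step) {V : Type*} (G : SimpleGraph V)
    (ident : V → ℕ) (n a t : ℕ) (ht : t ≤ (prog n a).length) (v : V) :
    (programAlgorithm prog).stateAfter G ident n a t v =
      ((prog n a).drop t, run G ((prog n a).take t) (initialData ident) v) := by
  induction t generalizing v with
  | zero => rfl
  | succ t ih =>
    have ih' := ih (by omega)
    have hrun : ∀ u, (programAlgorithm prog).out
        ((programAlgorithm prog).stateAfter G ident n a t u) = none := by
      intro u
      rw [ih']
      simp only [programAlgorithm, List.isEmpty_iff, List.drop_eq_nil_iff]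
      rw [if_neg (by omega)]
    rw [LocalAlgorithm.stateAfter]
    simp only [hrun, Option.isSome_none, Bool.false_eq_true, if_false]
    simp only [ih']
    obtain ⟨s, hs⟩ : ∃ s, (prog n a)[t]? = some s :=
      ⟨(prog n a)[t], List.getElem?_eq_getElem (by omega)⟩
    have hs' : (prog n a).drop t = s :: (prog n a).drop (t + 1) := by
      rw [List.drop_eq_getElem_cons (by omega)]
      rw [List.getElem?_eq_getElem (by omega)] at hs
      rw [Option.some.inj hs]
    rw [List.take_add_one, hs, run_append]
    simp only [programAlgorithm, hs', List.tail_cons, List.headD_cons, Option.toList_some,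
      run_cons, run_nil, runStep, true_and]
    congr 2
    ext m
    simp only [Set.mem_image, Set.mem_ofPred_eq]
    constructor
    · rintro ⟨q, ⟨u, hu, rfl⟩, rfl⟩
      exact ⟨u, hu, rfl⟩
    · rintro ⟨u, hu, rfl⟩
      exact ⟨_, ⟨u, hu, rfl⟩, rfl⟩

theorem colorsWithin_programAlgorithm (prog : ℕ → ℕ → List Step) {V : Type*} [Fintype V]
    (G : SimpleGraph V) (ident : V → ℕ) (a k : ℕ)
    (hlt : ∀ v, (run G (prog (Fintype.card V) a) (initialData ident) v).cls < k)
    (hne : ∀ u v, G.Adj u v → (run G (prog (Fintype.card V) a) (initialData ident) u).cls ≠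
      (run G (prog (Fintype.card V) a) (initialData ident) v).cls) :
    (programAlgorithm prog).ColorsWithin G ident a k (prog (Fintype.card V) a).length := by
  refine ⟨SimpleGraph.Coloring.mk (fun v => ⟨_, hlt v⟩) fun {u v} huv h =>
    hne u v huv (congrArg Fin.val h), fun v => ?_⟩
  rw [stateAfter_programAlgorithm _ _ _ _ _ _ le_rfl]
  simp [programAlgorithm]
  rfl

-- A step sees only a set of data, where equal data would merge. Distinct identity numbers make
-- counting in this set the same as counting neighbors.
open Classical in
theorem ncard_nbr {V : Type*} [Fintype V] {G : SimpleGraph V} {x : V → VertexData}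
    (hx : Function.Injective fun v => (x v).id) (v : V) (P : VertexData → Prop) :
    {m | m ∈ x '' {u | G.Adj v u} ∧ P m}.ncard =
      (Finset.univ.filter fun u => G.Adj v u ∧ P (x u)).card := by
  have hinj : Function.Injective x := fun u w h => hx (congrArg VertexData.id h)
  have : {m | m ∈ x '' {u | G.Adj v u} ∧ P m} = x '' {u | G.Adj v u ∧ P (x u)} := by
    ext m
    constructor
    · rintro ⟨⟨u, hu, rfl⟩, hP⟩; exact ⟨u, ⟨hu, hP⟩, rfl⟩
    · rintro ⟨u, ⟨hu, hP⟩, rfl⟩; exact ⟨⟨u, hu, rfl⟩, hP⟩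
  rw [this, Set.ncard_image_of_injective _ hinj, ← Set.ncard_coe_finset]
  congr 1
  ext u
  simp

end Programs

/-! ### Layers of small degree -/

section Layering

/-- Forget the layers. -/
def resetLayerStep : Step := fun d _ => { d with lay := 0 }

open Classical in
/-- An unlayered vertex with at most `4 * β` unlayered neighbors in its class enters layer `i`. -/
noncomputable def layerStep (β i : ℕ) : Step := fun d M =>
  if d.lay = 0 ∧ {m | m ∈ M ∧ (m.cls = d.cls ∧ m.lay = 0)}.ncard ≤ 4 * β then { d with lay := i }
  else d

/-- Computation of layers `1, …, L`. -/
noncomputable def layerProg (β L : ℕ) : List Step :=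
  resetLayerStep :: (List.range L).map fun i => layerStep β (i + 1)

open Classical in
/-- All vertices have a layer in `1, …, L`, and at most `A` neighbors of the same class in the
same or higher layers. -/
def IsLayering {V : Type*} [Fintype V] (G : SimpleGraph V) (A L : ℕ) (x : V → VertexData) :
    Prop :=
  ∀ v, 1 ≤ (x v).lay ∧ (x v).lay ≤ L ∧
    (Finset.univ.filter fun u => G.Adj v u ∧ (x u).cls = (x v).cls ∧ (x v).lay ≤ (x u).lay).card
      ≤ A

theorem layerStep_id (β i : ℕ) (d : VertexData) (M : Set VertexData) :
    (layerStep β i d M).id = d.id := by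
  unfold layerStep; split_ifs <;> rfl

theorem layerStep_cls (β i : ℕ) (d : VertexData) (M : Set VertexData) :
    (layerStep β i d M).cls = d.cls := by
  unfold layerStep; split_ifs <;> rfl

-- Layer 0 means not yet layered. Such vertices can only enter later layers, so they are counted as
-- lying above. By `OutDegreeBound.two_mul_card_le`, each round layers at least half of them.
open Classical in
theorem run_layerProg_aux {V : Type*} [Fintype V] {G : SimpleGraph V} {x : V → VertexData}
    (hx : Function.Injective fun v => (x v).id) {β : ℕ}
    (hβ : OutDegreeBound G (fun v => (x v).cls) β) (i : ℕ) :
    let y := run G (layerProg β i) x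
    (∀ v, (y v).id = (x v).id ∧ (y v).cls = (x v).cls ∧ (y v).lay ≤ i ∧ ((y v).lay ≠ 0 →
      (Finset.univ.filter fun u => G.Adj v u ∧ (x u).cls = (x v).cls ∧
        ((y u).lay = 0 ∨ (y v).lay ≤ (y u).lay)).card ≤ 4 * β)) ∧
    2 ^ i * (Finset.univ.filter fun v => (y v).lay = 0).card ≤ Fintype.card V := by
  induction i with
  | zero =>
    refine ⟨fun v => ⟨rfl, rfl, le_rfl, fun h => absurd rfl h⟩, ?_⟩
    simp [layerProg, runStep, resetLayerStep]
  | succ i ih =>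
    intro y
    set z := run G (layerProg β i) x with hz
    obtain ⟨hv, hcard⟩ := ih
    have hy : y = runStep G (layerStep β (i + 1)) z := by
      simp [y, hz, layerProg, List.range_succ]
    have hzid : Function.Injective fun v => (z v).id := by
      simpa only [fun v => (hv v).1] using hx
    have hcount : ∀ v, {m | m ∈ z '' {u | G.Adj v u} ∧ (m.cls = (z v).cls ∧ m.lay = 0)}.ncard =
        (Finset.univ.filter fun u => G.Adj v u ∧ (x u).cls = (x v).cls ∧ (z u).lay = 0).card := by
      intro v
      rw [ncard_nbr hzid v fun m => m.cls = (z v).cls ∧ m.lay = 0]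
      simp only [fun v => (hv v).2.1]
    have hylay : ∀ v, (y v).lay = if (z v).lay = 0 ∧ (Finset.univ.filter fun u => G.Adj v u ∧
        (x u).cls = (x v).cls ∧ (z u).lay = 0).card ≤ 4 * β then i + 1 else (z v).lay := by
      intro v
      rw [hy, runStep, layerStep, hcount]
      split_ifs <;> rfl
    refine ⟨fun v => ⟨?_, ?_, ?_, fun hne => ?_⟩, ?_⟩
    · rw [hy, runStep, layerStep_id]; exact (hv v).1
    · rw [hy, runStep, layerStep_cls]; exact (hv v).2.1
    · have := (hv v).2.2.1
      rw [hylay]; split_ifs <;> omega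
    · by_cases hc : (z v).lay = 0 ∧ (Finset.univ.filter fun u => G.Adj v u ∧
        (x u).cls = (x v).cls ∧ (z u).lay = 0).card ≤ 4 * β
      · refine le_trans (Finset.card_le_card ?_) hc.2
        have h1 : (y v).lay = i + 1 := by rw [hylay, if_pos hc]
        intro u hu
        simp only [Finset.mem_filter, Finset.mem_univ, true_and] at hu ⊢
        refine ⟨hu.1, hu.2.1, ?_⟩
        have h2 := hu.2.2
        have h3 := (hv u).2.2.1
        rw [h1, hylay] at h2
        split_ifs at h2 with h4
        · exact h4.1
        · omega
      · have h1 : (y v).lay = (z v).lay := by rw [hylay, if_neg hc]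
        rw [h1] at hne ⊢
        refine le_trans (Finset.card_le_card ?_) ((hv v).2.2.2 hne)
        intro u hu
        simp only [Finset.mem_filter, Finset.mem_univ, true_and] at hu ⊢
        refine ⟨hu.1, hu.2.1, ?_⟩
        have h2 := hu.2.2
        rw [hylay] at h2
        split_ifs at h2 with h4
        · exact Or.inl h4.1
        · exact h2
    · set S := Finset.univ.filter fun v => (z v).lay = 0
      have hsub : (Finset.univ.filter fun v => (y v).lay = 0) ⊆
          S.filter fun v => 4 * β < (S.filter fun u => G.Adj v u ∧ (x u).cls = (x v).cls).card := by
        intro v hv0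
        simp only [Finset.mem_filter, Finset.mem_univ, true_and, S] at hv0 ⊢
        rw [hylay] at hv0
        split_ifs at hv0 with h4
        rw [Finset.filter_filter]
        refine ⟨hv0, ?_⟩
        have h5 := not_le.1 fun h => h4 ⟨hv0, h⟩
        refine h5.trans_le (Finset.card_le_card fun u hu => ?_)
        simp only [Finset.mem_filter, Finset.mem_univ, true_and] at hu ⊢
        exact ⟨hu.2.2, hu.1, hu.2.1⟩
      have h1 := Finset.card_le_card hsub
      have h2 := hβ.two_mul_card_le S
      calc 2 ^ (i + 1) * (Finset.univ.filter fun v => (y v).lay = 0).card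
          = 2 ^ i * (2 * (Finset.univ.filter fun v => (y v).lay = 0).card) := by ring
        _ ≤ 2 ^ i * S.card := Nat.mul_le_mul_left _ (by omega)
        _ ≤ _ := hcard

theorem run_layerProg {V : Type*} [Fintype V] {G : SimpleGraph V} {x : V → VertexData}
    (hx : Function.Injective fun v => (x v).id) {β L : ℕ}
    (hβ : OutDegreeBound G (fun v => (x v).cls) β) (hL : Fintype.card V < 2 ^ L) :
    (∀ v, (run G (layerProg β L) x v).id = (x v).id ∧
      (run G (layerProg β L) x v).cls = (x v).cls) ∧
    IsLayering G (4 * β) L (run G (layerProg β L) x) := by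
  classical
  obtain ⟨h1, h2⟩ := run_layerProg_aux hx hβ L
  refine ⟨fun v => ⟨(h1 v).1, (h1 v).2.1⟩, fun v => ?_⟩
  set y := run G (layerProg β L) x
  have h0 : (Finset.univ.filter fun v => (y v).lay = 0).card = 0 := by
    by_contra hne
    have := Nat.mul_le_mul_left (2 ^ L) (Nat.one_le_iff_ne_zero.2 hne)
    omega
  have hne : (y v).lay ≠ 0 := fun h => by
    have : v ∈ Finset.univ.filter fun v => (y v).lay = 0 := by simpa using h
    rw [Finset.card_eq_zero.1 h0] at this
    exact absurd this (Finset.notMem_empty v)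
  refine ⟨Nat.one_le_iff_ne_zero.2 hne, (h1 v).2.2.1, le_trans (Finset.card_le_card ?_)
    ((h1 v).2.2.2 hne)⟩
  intro u hu
  simp only [Finset.mem_filter, Finset.mem_univ, true_and] at hu ⊢
  rw [(h1 u).2.1, (h1 v).2.1] at hu
  exact ⟨hu.1, hu.2.1, Or.inr hu.2.2⟩

end Layering

/-! ### Defective coloring by polynomials -/

section Refinement

/-- `m` is an out-neighbor of `d`: it is in the same class and above `d` in the order by layers
and then by identity numbers. -/
def IsAbove (d m : VertexData) : Prop :=
  m.cls = d.cls ∧ (d.lay < m.lay ∨ d.lay = m.lay ∧ d.id < m.id)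

/-- Start the auxiliary coloring with the identity numbers. -/
def resetPsiStep : Step := fun d _ => { d with psi := d.id }

/-- The evaluation point at which few out-neighbors agree with `d`. -/
noncomputable def refinePoint (p : ℕ) (d : VertexData) (M : Set VertexData) : ℕ :=
  lowIndex p fun y => {m | m ∈ M ∧ (IsAbove d m ∧ m.psi ≠ d.psi ∧
    digitEval p m.psi y = digitEval p d.psi y)}.ncard

/-- Replace the auxiliary color by a point of the graph of the polynomial that it encodes. -/
noncomputable def refineStep (p : ℕ) : Step := fun d M =>
  { d with psi := p * refinePoint p d M + digitEval p d.psi (refinePoint p d M) }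

/-- Refinement with `scalePrime j` for `j = j₀ + i - 1, …, j₀`. -/
noncomputable def refineRounds (j₀ : ℕ) : ℕ → List Step
  | 0 => []
  | i + 1 => refineStep (scalePrime (j₀ + i)) :: refineRounds j₀ i

open Classical in
/-- The auxiliary coloring uses colors below `p`, and every vertex has at most `D / q`
out-neighbors of its own auxiliary color. -/
def IsDefective {V : Type*} [Fintype V] (G : SimpleGraph V) (p q D : ℕ) (x : V → VertexData) :
    Prop :=
  ∀ v, (x v).psi < p ∧
    (Finset.univ.filter fun u => G.Adj v u ∧ IsAbove (x v) (x u) ∧ (x u).psi = (x v).psi).card * q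
      ≤ D

/-- All registers but `psi` agree. -/
def EqExceptPsi (d e : VertexData) : Prop :=
  d.id = e.id ∧ d.cls = e.cls ∧ d.lay = e.lay

theorem isAbove_congr {d d' m m' : VertexData} (h : EqExceptPsi d d') (h' : EqExceptPsi m m') :
    IsAbove d m ↔ IsAbove d' m' := by
  rw [IsAbove, IsAbove, h.1, h.2.1, h.2.2, h'.1, h'.2.1, h'.2.2]

open Classical in
theorem IsLayering.card_isAbove_le {V : Type*} [Fintype V] {G : SimpleGraph V} {A L : ℕ}
    {x : V → VertexData} (h : IsLayering G A L x) (v : V) :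
    (Finset.univ.filter fun u => G.Adj v u ∧ IsAbove (x v) (x u)).card ≤ A := by
  refine le_trans (Finset.card_le_card ?_) (h v).2.2
  intro u hu
  simp only [Finset.mem_filter, Finset.mem_univ, true_and] at hu ⊢
  obtain ⟨h1, h2, h3⟩ := hu
  exact ⟨h1, h2, by omega⟩

theorem IsLayering.congr {V : Type*} [Fintype V] {G : SimpleGraph V} {A L : ℕ}
    {x y : V → VertexData} (h : IsLayering G A L x) (hxy : ∀ v, EqExceptPsi (y v) (x v)) :
    IsLayering G A L y := by
  intro v
  obtain ⟨h1, h2, h3⟩ := h v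
  rw [(hxy v).2.2]
  refine ⟨h1, h2, le_trans (Finset.card_le_card fun u hu => ?_) h3⟩
  simpa only [Finset.mem_filter, (hxy _).2.1, (hxy _).2.2] using hu

-- An out-neighbor of another color agrees at no more than 4 of the p points, so a point of at most
-- average agreement creates at most 4A/p ≤ 4A/2^j new conflicts. The old ones number at most
-- 8A/2^(j+1) = 4A/2^j, and the sum is again within the bound for scale `j`.
open Classical in
theorem runStep_refineStep {V : Type*} [Fintype V] {G : SimpleGraph V} {x : V → VertexData}
    (hx : Function.Injective fun v => (x v).id) {A L j q : ℕ} (hlay : IsLayering G A L x)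
    (hq : q ≤ scalePrime j ^ 5) (h : IsDefective G q (2 ^ (j + 1)) (8 * A) x) :
    IsDefective G (scalePrime j ^ 2) (2 ^ j) (8 * A)
      (runStep G (refineStep (scalePrime j)) x) := by
  set p := scalePrime j
  have hp : p.Prime := scalePrime_prime j
  have hpj : 2 ^ j < p := lt_scalePrime j
  intro v
  set w := refinePoint p (x v) (x '' {u | G.Adj v u}) with hw
  set F : ℕ → ℕ := fun y => (Finset.univ.filter fun u => G.Adj v u ∧ (IsAbove (x v) (x u) ∧
    (x u).psi ≠ (x v).psi ∧ digitEval p (x u).psi y = digitEval p (x v).psi y)).card with hF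
  have hwF : w = lowIndex p F := by
    rw [hw, refinePoint]
    congr 1
    funext y
    rw [hF]
    convert ncard_nbr hx v fun m => IsAbove (x v) m ∧ m.psi ≠ (x v).psi ∧
      digitEval p m.psi y = digitEval p (x v).psi y
  have hwp : w < p := hwF ▸ lowIndex_lt hp.pos F
  have hpsi : ∀ u, (runStep G (refineStep p) x u).psi =
      p * refinePoint p (x u) (x '' {u' | G.Adj u u'}) +
        digitEval p (x u).psi (refinePoint p (x u) (x '' {u' | G.Adj u u'})) := fun u => rfl
  have hev : ∀ c y, digitEval p c y < p := fun c y => Nat.mod_lt _ hp.pos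
  have hFw : p * F w ≤ 4 * A := by
    have h1 : p * F w ≤ ∑ y ∈ Finset.range p, F y := by rw [hwF]; exact mul_lowIndex_le hp.pos F
    refine h1.trans ?_
    set N := Finset.univ.filter fun u => G.Adj v u ∧ IsAbove (x v) (x u) with hN
    have h2 : ∀ y, F y = ∑ u ∈ N, if (x u).psi ≠ (x v).psi ∧
        digitEval p (x u).psi y = digitEval p (x v).psi y then 1 else 0 := by
      intro y
      rw [← Finset.card_filter, hN, Finset.filter_filter]
      simp only [hF, and_assoc]
    simp only [h2]
    rw [Finset.sum_comm]
    have h3 : ∀ u ∈ N, (∑ y ∈ Finset.range p, if (x u).psi ≠ (x v).psi ∧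
        digitEval p (x u).psi y = digitEval p (x v).psi y then 1 else 0) ≤ 4 := by
      intro u _
      rw [← Finset.card_filter]
      by_cases hne : (x u).psi = (x v).psi
      · simp [hne]
      · simp only [ne_eq, hne, not_false_eq_true, true_and]
        exact card_digitEval_eq_le hp ((h u).1.trans_le hq) ((h v).1.trans_le hq) hne
    refine (Finset.sum_le_card_nsmul _ _ _ h3).trans ?_
    rw [smul_eq_mul, mul_comm]
    exact Nat.mul_le_mul_left _ (hlay.card_isAbove_le v)
  refine ⟨?_, ?_⟩
  · rw [hpsi, ← hw]
    calc p * w + digitEval p (x v).psi w < p * w + p := by have := hev (x v).psi w; omega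
      _ = p * (w + 1) := by ring
      _ ≤ p * p := Nat.mul_le_mul_left _ hwp
      _ = p ^ 2 := by ring
  · have hsub : (Finset.univ.filter fun u => G.Adj v u ∧
        IsAbove (runStep G (refineStep p) x v) (runStep G (refineStep p) x u) ∧
        (runStep G (refineStep p) x u).psi = (runStep G (refineStep p) x v).psi) ⊆
        (Finset.univ.filter fun u => G.Adj v u ∧ IsAbove (x v) (x u) ∧ (x u).psi = (x v).psi) ∪
        (Finset.univ.filter fun u => G.Adj v u ∧ (IsAbove (x v) (x u) ∧
          (x u).psi ≠ (x v).psi ∧ digitEval p (x u).psi w = digitEval p (x v).psi w)) := by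
      intro u hu
      simp only [Finset.mem_filter, Finset.mem_univ, true_and, Finset.mem_union] at hu ⊢
      obtain ⟨hadj, habove, heq⟩ := hu
      have habove' : IsAbove (x v) (x u) := habove
      by_cases hne : (x u).psi = (x v).psi
      · exact Or.inl ⟨hadj, habove', hne⟩
      · refine Or.inr ⟨hadj, habove', hne, ?_⟩
        rw [hpsi, hpsi, ← hw] at heq
        -- Quotient and remainder modulo `p` recover the evaluation point and the value.
        have hm := congrArg (· / p) heq
        have hm' := congrArg (· % p) heq
        simp only [Nat.mul_add_mod, Nat.mod_eq_of_lt (hev _ _)] at hm'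
        simp only [Nat.mul_add_div hp.pos, Nat.div_eq_of_lt (hev _ _), add_zero] at hm
        rw [hm] at hm'
        exact hm'
    have h1 := (Finset.card_le_card hsub).trans (Finset.card_union_le _ _)
    have h2 := (h v).2
    have h3 : F w * 2 ^ j ≤ 4 * A := le_trans (by
      rw [mul_comm]; exact Nat.mul_le_mul_right _ hpj.le) hFw
    rw [pow_succ] at h2
    have h4 := Nat.mul_le_mul_right (2 ^ j) h1
    rw [add_mul] at h4
    refine h4.trans ?_
    change _ + F w * 2 ^ j ≤ _
    linarith

theorem run_refineRounds {V : Type*} [Fintype V] {G : SimpleGraph V} {A L j₀ : ℕ} (hj : 2 ≤ j₀)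
    (i : ℕ) {x : V → VertexData} (hx : Function.Injective fun v => (x v).id)
    (hlay : IsLayering G A L x) {q : ℕ} (hq : q ≤ scalePrime (j₀ + i) ^ 5)
    (h : IsDefective G q (2 ^ (j₀ + i + 1)) (8 * A) x) :
    (∀ v, EqExceptPsi (run G (refineRounds j₀ (i + 1)) x v) (x v)) ∧
    IsDefective G (scalePrime j₀ ^ 2) (2 ^ j₀) (8 * A) (run G (refineRounds j₀ (i + 1)) x) := by
  induction i generalizing x q with
  | zero =>
    exact ⟨fun v => ⟨rfl, rfl, rfl⟩, runStep_refineStep hx hlay hq h⟩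
  | succ i ih =>
    have h1 := runStep_refineStep hx hlay hq h
    obtain ⟨h2, h3⟩ := ih (x := runStep G (refineStep (scalePrime (j₀ + (i + 1)))) x)
      hx (hlay.congr fun v => ⟨rfl, rfl, rfl⟩)
      (scalePrime_succ_sq_le (by omega)) h1
    exact ⟨h2, h3⟩

/-- The computation of a defective coloring with colors below `scalePrime j₀ ^ 2` from identity
numbers below `2 ^ L`. -/
noncomputable def refineProg (j₀ L : ℕ) : List Step :=
  resetPsiStep :: refineRounds j₀ (L - j₀ + 1)

theorem run_refineProg {V : Type*} [Fintype V] {G : SimpleGraph V} {A L j₀ : ℕ} (hj : 2 ≤ j₀)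
    {x : V → VertexData} (hx : Function.Injective fun v => (x v).id)
    (hlay : IsLayering G A L x) (hid : ∀ v, (x v).id < 2 ^ L) :
    (∀ v, EqExceptPsi (run G (refineProg j₀ L) x v) (x v)) ∧
    IsDefective G (scalePrime j₀ ^ 2) (2 ^ j₀) (8 * A) (run G (refineProg j₀ L) x) := by
  classical
  -- The truncated difference also covers `L < j₀`, where the exponent is simply `j₀`.
  have hq : 2 ^ L ≤ scalePrime (j₀ + (L - j₀)) ^ 5 := by
    calc 2 ^ L ≤ 2 ^ (j₀ + (L - j₀)) := Nat.pow_le_pow_right (by norm_num) (by omega)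
      _ ≤ scalePrime (j₀ + (L - j₀)) := (lt_scalePrime _).le
      _ ≤ _ := Nat.le_self_pow (by norm_num) _
  have h := run_refineRounds hj (L - j₀) (x := runStep G resetPsiStep x) hx
    (hlay.congr fun v => ⟨rfl, rfl, rfl⟩) hq fun v => ⟨hid v, ?_⟩
  · exact h
  -- Identity numbers are distinct, so initially there are no conflicts.
  · rw [Finset.card_eq_zero.2, zero_mul]
    · exact Nat.zero_le _
    · refine Finset.filter_eq_empty_iff.2 fun u _ hu => G.ne_of_adj hu.1 ?_
      exact hx hu.2.2.symm

end Refinement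

/-! ### Greedy choice of rare colors, slot by slot -/

section Greedy

/-- The time slot of a vertex, by layers and then by auxiliary colors below `Q`. -/
def key (Q : ℕ) (d : VertexData) : ℕ := d.lay * Q + d.psi

/-- The vertices of slot `s` choose, among `k` colors, one that is rare among their neighbors in
the same class and in later slots. -/
noncomputable def greedyStep (Q k s : ℕ) : Step :=
  open Classical in fun d M =>
    if key Q d = s then
      { d with kc := lowIndex k fun c =>
          {m | m ∈ M ∧ (m.cls = d.cls ∧ s < key Q m ∧ m.kc = c)}.ncard }
    else d

/-- The slots below `s`, in descending order. -/
noncomputable def greedyRounds (Q k : ℕ) : ℕ → List Step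
  | 0 => []
  | s + 1 => greedyStep Q k s :: greedyRounds Q k s

/-- All registers but `kc` agree. -/
def EqExceptKc (d e : VertexData) : Prop :=
  d.id = e.id ∧ d.cls = e.cls ∧ d.lay = e.lay ∧ d.psi = e.psi

theorem EqExceptKc.trans {d e f : VertexData} (h : EqExceptKc d e) (h' : EqExceptKc e f) :
    EqExceptKc d f :=
  ⟨h.1.trans h'.1, h.2.1.trans h'.2.1, h.2.2.1.trans h'.2.2.1, h.2.2.2.trans h'.2.2.2⟩

theorem EqExceptKc.key_eq {d e : VertexData} (h : EqExceptKc d e) (Q : ℕ) :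
    key Q d = key Q e := by
  rw [key, key, h.2.2.1, h.2.2.2]

theorem eqExceptKc_greedyStep (Q k s : ℕ) (d : VertexData) (M : Set VertexData) :
    EqExceptKc (greedyStep Q k s d M) d := by
  unfold greedyStep; split_ifs <;> exact ⟨rfl, rfl, rfl, rfl⟩

open Classical in
/-- The vertices in slots from `s` on have chosen one of `k` colors, with at most `A / k`
conflicts with later slots. -/
def IsGreedyFrom {V : Type*} [Fintype V] (G : SimpleGraph V) (Q k A s : ℕ)
    (x : V → VertexData) : Prop :=
  ∀ v, s ≤ key Q (x v) → (x v).kc < k ∧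
    k * (Finset.univ.filter fun u => G.Adj v u ∧ (x u).cls = (x v).cls ∧
      key Q (x v) < key Q (x u) ∧ (x u).kc = (x v).kc).card ≤ A

-- Vertices of slot `s` look only at later slots, whose colors are already final, so they can act
-- simultaneously. The counts over the `k` colors sum to at most `A`, so the chosen one is at most
-- A/k.
open Classical in
theorem runStep_greedyStep {V : Type*} [Fintype V] {G : SimpleGraph V} {x : V → VertexData}
    (hx : Function.Injective fun v => (x v).id) {Q k A s : ℕ} (hk : 0 < k)
    (hA : ∀ v, (Finset.univ.filter fun u => G.Adj v u ∧ (x u).cls = (x v).cls ∧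
      key Q (x v) < key Q (x u)).card ≤ A)
    (h : IsGreedyFrom G Q k A (s + 1) x) :
    IsGreedyFrom G Q k A s (runStep G (greedyStep Q k s) x) := by
  set y := runStep G (greedyStep Q k s) x
  have hyx : ∀ v, EqExceptKc (y v) (x v) := fun v => eqExceptKc_greedyStep _ _ _ _ _
  have hold : ∀ v, key Q (x v) ≠ s → y v = x v := fun v hv => by
    simp only [y, runStep, greedyStep, if_neg hv]
  intro v hv
  rw [(hyx v).key_eq] at hv
  by_cases hs : key Q (x v) = s
  · set F : ℕ → ℕ := fun c => (Finset.univ.filter fun u => G.Adj v u ∧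
      ((x u).cls = (x v).cls ∧ s < key Q (x u) ∧ (x u).kc = c)).card with hF
    have hkc : (y v).kc = lowIndex k F := by
      simp only [y, runStep, greedyStep, if_pos hs]
      congr 1
      funext c
      rw [hF]
      convert ncard_nbr hx v fun m => m.cls = (x v).cls ∧ s < key Q m ∧ m.kc = c
    refine ⟨hkc ▸ lowIndex_lt hk F, ?_⟩
    have h1 : (Finset.univ.filter fun u => G.Adj v u ∧ (y u).cls = (y v).cls ∧
        key Q (y v) < key Q (y u) ∧ (y u).kc = (y v).kc).card ≤ F (lowIndex k F) := by
      refine Finset.card_le_card fun u hu => ?_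
      simp only [Finset.mem_filter, Finset.mem_univ, true_and] at hu ⊢
      obtain ⟨h1, h2, h3, h4⟩ := hu
      rw [(hyx u).2.1, (hyx v).2.1] at h2
      rw [(hyx u).key_eq, (hyx v).key_eq, hs] at h3
      rw [hold u h3.ne', hkc] at h4
      exact ⟨h1, h2, h3, h4⟩
    refine (Nat.mul_le_mul_left k h1).trans ((mul_lowIndex_le hk F).trans (le_trans ?_ (hA v)))
    rw [← Finset.card_biUnion]
    · refine Finset.card_le_card fun u hu => ?_
      simp only [Finset.mem_biUnion, Finset.mem_filter, Finset.mem_univ, true_and] at hu ⊢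
      obtain ⟨c, -, h1, h2, h3, -⟩ := hu
      exact ⟨h1, h2, hs ▸ h3⟩
    · intro c _ c' _ hcc
      refine Finset.disjoint_left.2 fun u hu hu' => hcc ?_
      rw [Finset.mem_filter] at hu hu'
      exact hu.2.2.2.2.symm.trans hu'.2.2.2.2
  · obtain ⟨h1, h2⟩ := h v (by omega)
    rw [hold v hs]
    refine ⟨h1, le_trans (Nat.mul_le_mul_left k (Finset.card_le_card fun u hu => ?_)) h2⟩
    simp only [Finset.mem_filter, Finset.mem_univ, true_and] at hu ⊢
    obtain ⟨h1, h2, h3, h4⟩ := hu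
    rw [(hyx u).key_eq] at h3
    rw [hold u (by omega)] at h2 h4
    exact ⟨h1, h2, h3, h4⟩

open Classical in
theorem run_greedyRounds {V : Type*} [Fintype V] {G : SimpleGraph V} {Q k A : ℕ} (hk : 0 < k)
    (s : ℕ) {x : V → VertexData} (hx : Function.Injective fun v => (x v).id)
    (hA : ∀ v, (Finset.univ.filter fun u => G.Adj v u ∧ (x u).cls = (x v).cls ∧
      key Q (x v) < key Q (x u)).card ≤ A)
    (h : IsGreedyFrom G Q k A s x) :
    (∀ v, EqExceptKc (run G (greedyRounds Q k s) x v) (x v)) ∧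
    IsGreedyFrom G Q k A 0 (run G (greedyRounds Q k s) x) := by
  induction s generalizing x with
  | zero => exact ⟨fun v => ⟨rfl, rfl, rfl, rfl⟩, h⟩
  | succ s ih =>
    have hyx : ∀ v, EqExceptKc (runStep G (greedyStep Q k s) x v) (x v) :=
      fun v => eqExceptKc_greedyStep _ _ _ _ _
    obtain ⟨h1, h2⟩ := ih (x := runStep G (greedyStep Q k s) x)
      (fun u v huv => hx (by simpa only [(hyx _).1] using huv))
      (fun v => le_trans (Finset.card_le_card fun u hu => by
        simpa only [Finset.mem_filter, (hyx _).2.1, (hyx _).key_eq] using hu) (hA v))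
      (runStep_greedyStep hx hk hA h)
    exact ⟨fun v => (h1 v).trans (hyx v), h2⟩

end Greedy

/-! ### One phase, repeated phases, and the final legal coloring -/

section Phases

theorem lay_le_of_key_le {Q : ℕ} {d e : VertexData} (he : e.psi < Q)
    (h : key Q d ≤ key Q e) : d.lay ≤ e.lay := by
  by_contra hlt
  have h1 : (e.lay + 1) * Q ≤ d.lay * Q := Nat.mul_le_mul_right Q (by omega)
  rw [add_mul, one_mul] at h1
  unfold key at h
  omega

/-- The greedily chosen color splits the classes. -/
def combineStep (k : ℕ) : Step := fun d _ => { d with cls := k * d.cls + d.kc }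

/-- The number of auxiliary colors in a phase that splits the classes into `2 ^ m` parts. -/
noncomputable def phasePalette (m : ℕ) : ℕ := scalePrime (m + 3) ^ 2

/-- Every class, with out-degree bound `β`, is split into `2 ^ m` classes. -/
noncomputable def phaseProg (m L β : ℕ) : List Step :=
  layerProg β L ++ (refineProg (m + 3) L ++
    (greedyRounds (phasePalette m) (2 ^ m) ((L + 1) * phasePalette m) ++ [combineStep (2 ^ m)]))

theorem mul_add_inj {k a b c d : ℕ} (hb : b < k) (hd : d < k) (h : k * a + b = k * c + d) :
    a = c ∧ b = d := by
  have h1 := congrArg (· / k) h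
  have h2 := congrArg (· % k) h
  have hk : 0 < k := by omega
  simp only [Nat.mul_add_div hk, Nat.div_eq_of_lt hb, Nat.div_eq_of_lt hd, add_zero] at h1
  simp only [Nat.mul_add_mod, Nat.mod_eq_of_lt hb, Nat.mod_eq_of_lt hd] at h2
  exact ⟨h1, h2⟩

theorem mul_add_lt {k a b M : ℕ} (hb : b < k) (ha : a < M) : k * a + b < k * M := by
  have := Nat.mul_le_mul_left k (Nat.succ_le_of_lt ha)
  rw [Nat.mul_succ] at this
  omega

-- Orient toward later slots, then toward larger identities. Equal slots mean equal layer and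
-- auxiliary color, so ties are bounded by the defect 8A/2^(m+3) = A/2^m, and later slots by the
-- greedy bound A/2^m.
open Classical in
theorem outDegreeBound_combineStep {V : Type*} [Fintype V] {G : SimpleGraph V}
    {x : V → VertexData} (hx : Function.Injective fun v => (x v).id) {m A Q β b : ℕ}
    (hA : A ≤ 4 * β) (hb : ∀ t, t * 2 ^ m ≤ 8 * β → t ≤ b)
    (hdef : IsDefective G Q (2 ^ (m + 3)) (8 * A) x) (hgr : IsGreedyFrom G Q (2 ^ m) A 0 x) :
    OutDegreeBound G (fun v => (runStep G (combineStep (2 ^ m)) x v).cls) b := by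
  refine ⟨fun v u => G.Adj v u ∧ (x u).cls = (x v).cls ∧ (x u).kc = (x v).kc ∧
    (key Q (x v) < key Q (x u) ∨ key Q (x v) = key Q (x u) ∧ (x v).id < (x u).id),
    fun u v huv heq => ?_, fun v => hb _ ?_⟩
  · obtain ⟨h1, h2⟩ := mul_add_inj (hgr u (Nat.zero_le _)).1 (hgr v (Nat.zero_le _)).1 heq
    have hid : (x u).id ≠ (x v).id := fun h => G.ne_of_adj huv (hx h)
    rcases lt_trichotomy (key Q (x u)) (key Q (x v)) with h | h | h
    · exact Or.inl ⟨huv, h1.symm, h2.symm, Or.inl h⟩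
    · rcases lt_or_gt_of_ne hid with h' | h'
      · exact Or.inl ⟨huv, h1.symm, h2.symm, Or.inr ⟨h, h'⟩⟩
      · exact Or.inr ⟨huv.symm, h1, h2, Or.inr ⟨h.symm, h'⟩⟩
    · exact Or.inr ⟨huv.symm, h1, h2, Or.inl h⟩
  · have h1 := (hgr v (Nat.zero_le _)).2
    have h2 := (hdef v).2
    refine (Nat.mul_le_mul_right _ ((Finset.card_le_card (t :=
      (Finset.univ.filter fun u => G.Adj v u ∧ (x u).cls = (x v).cls ∧
        key Q (x v) < key Q (x u) ∧ (x u).kc = (x v).kc) ∪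
      (Finset.univ.filter fun u => G.Adj v u ∧ IsAbove (x v) (x u) ∧ (x u).psi = (x v).psi))
      fun u hu => ?_).trans (Finset.card_union_le _ _))).trans ?_
    · simp only [Finset.mem_filter, Finset.mem_univ, true_and, Finset.mem_union] at hu ⊢
      obtain ⟨hadj, hcls, hkc, hkey | ⟨hkey, hid⟩⟩ := hu
      · exact Or.inl ⟨hadj, hcls, hkey, hkc⟩
      · have hl := le_antisymm (lay_le_of_key_le (hdef u).1 hkey.le)
          (lay_le_of_key_le (hdef v).1 hkey.ge)
        refine Or.inr ⟨hadj, ⟨hcls, Or.inr ⟨hl, hid⟩⟩, ?_⟩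
        unfold key at hkey
        rw [hl] at hkey
        omega
    · rw [pow_add] at h2
      rw [add_mul]
      linarith

theorem run_phaseProg {V : Type*} [Fintype V] {G : SimpleGraph V} {x : V → VertexData}
    (hx : Function.Injective fun v => (x v).id) {m L β M : ℕ} (hm : 3 ≤ m)
    (hV : Fintype.card V < 2 ^ L) (hid : ∀ v, (x v).id < 2 ^ L)
    (hβ : OutDegreeBound G (fun v => (x v).cls) β) (hM : ∀ v, (x v).cls < M) :
    (∀ v, (run G (phaseProg m L β) x v).id = (x v).id ∧
      (run G (phaseProg m L β) x v).cls < 2 ^ m * M) ∧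
    OutDegreeBound G (fun v => (run G (phaseProg m L β) x v).cls) (β / 2 ^ (m - 3)) := by
  classical
  set Q := phasePalette m with hQ
  set y := run G (layerProg β L) x with hy
  obtain ⟨hyx, hylay⟩ := run_layerProg hx hβ hV
  rw [← hy] at hyx hylay
  have hyid : Function.Injective fun v => (y v).id := by
    simpa only [fun v => (hyx v).1] using hx
  set z := run G (refineProg (m + 3) L) y with hz
  obtain ⟨hzy, hzdef⟩ := run_refineProg (j₀ := m + 3) (by omega) hyid hylay
    fun v => by rw [(hyx v).1]; exact hid v
  rw [← hz, ← phasePalette, ← hQ] at hzdef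
  rw [← hz] at hzy
  have hzlay := hylay.congr hzy
  have hzid : Function.Injective fun v => (z v).id := by
    simpa only [fun v => (hzy v).1] using hyid
  have hk : 0 < 2 ^ m := by positivity
  set w := run G (greedyRounds Q (2 ^ m) ((L + 1) * Q)) z with hw
  obtain ⟨hwz, hwgr⟩ := run_greedyRounds (G := G) (Q := Q) (A := 4 * β) hk ((L + 1) * Q) hzid
    (fun v => le_trans (Finset.card_le_card fun u hu => by
      simp only [Finset.mem_filter, Finset.mem_univ, true_and] at hu ⊢
      exact ⟨hu.1, hu.2.1, lay_le_of_key_le (hzdef u).1 hu.2.2.le⟩) (hzlay v).2.2)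
    -- Layers are at most `L` and auxiliary colors below `Q`, so no slot reaches `(L + 1) * Q` and
    -- the greedy invariant holds vacuously at the start.
    (fun v hv => by
      have h1 := (hzdef v).1
      have h2 := Nat.mul_le_mul_right Q (hzlay v).2.1
      rw [add_mul, one_mul] at hv
      unfold key at hv
      omega)
  rw [← hw] at hwz hwgr
  have hwid : Function.Injective fun v => (w v).id := by
    simpa only [fun v => (hwz v).1] using hzid
  have hwdef : IsDefective G Q (2 ^ (m + 3)) (8 * (4 * β)) w := fun v => by
    refine ⟨(hwz v).2.2.2 ▸ (hzdef v).1, le_trans (Nat.mul_le_mul_right _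
      (Finset.card_le_card fun u hu => ?_)) (hzdef v).2⟩
    simp only [Finset.mem_filter, Finset.mem_univ, true_and] at hu ⊢
    rw [(hwz u).2.2.2, (hwz v).2.2.2, isAbove_congr ⟨(hwz v).1, (hwz v).2.1, (hwz v).2.2.1⟩
      ⟨(hwz u).1, (hwz u).2.1, (hwz u).2.2.1⟩] at hu
    exact hu
  have hrun : run G (phaseProg m L β) x = runStep G (combineStep (2 ^ m)) w := by
    simp only [phaseProg, run_append, run_cons, run_nil, hw, hz, hy, hQ]
  rw [hrun]
  refine ⟨fun v => ⟨(hwz v).1.trans ((hzy v).1.trans (hyx v).1), ?_⟩,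
    outDegreeBound_combineStep (β := β) hwid le_rfl (fun t ht => ?_) hwdef hwgr⟩
  · refine mul_add_lt (hwgr v (Nat.zero_le _)).1 ?_
    rw [(hwz v).2.1, (hzy v).2.1, (hyx v).2]
    exact hM v
  · rw [Nat.le_div_iff_mul_le (by positivity)]
    obtain ⟨i, rfl⟩ : ∃ i, m = i + 3 := ⟨m - 3, by omega⟩
    rw [pow_add] at ht
    simp only [Nat.add_sub_cancel]
    linarith

/-- A sequence of `r` phases. -/
noncomputable def phases (m L : ℕ) : ℕ → ℕ → List Step
  | 0, _ => []
  | r + 1, β => phaseProg m L β ++ phases m L r (β / 2 ^ (m - 3))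

theorem run_phases {V : Type*} [Fintype V] {G : SimpleGraph V} {m L : ℕ} (hm : 3 ≤ m)
    (hV : Fintype.card V < 2 ^ L) (r : ℕ) {β M : ℕ} {x : V → VertexData}
    (hx : Function.Injective fun v => (x v).id) (hid : ∀ v, (x v).id < 2 ^ L)
    (hβ : OutDegreeBound G (fun v => (x v).cls) β) (hM : ∀ v, (x v).cls < M) :
    (∀ v, (run G (phases m L r β) x v).id = (x v).id ∧
      (run G (phases m L r β) x v).cls < 2 ^ (m * r) * M) ∧
    OutDegreeBound G (fun v => (run G (phases m L r β) x v).cls)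
      (β / 2 ^ ((m - 3) * r)) := by
  induction r generalizing β M x with
  | zero => simpa [phases] using ⟨hM, hβ⟩
  | succ r ih =>
    obtain ⟨h1, h2⟩ := run_phaseProg hx hm hV hid hβ hM
    obtain ⟨h3, h4⟩ := ih (x := run G (phaseProg m L β) x)
      (by simpa only [fun v => (h1 v).1] using hx) (fun v => by rw [(h1 v).1]; exact hid v)
      h2 (fun v => (h1 v).2)
    simp only [phases, run_append]
    refine ⟨fun v => ⟨(h3 v).1.trans (h1 v).1, (h3 v).2.trans_le (le_of_eq ?_)⟩, ?_⟩
    · ring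
    · rwa [Nat.div_div_eq_div_mul, ← pow_add, Nat.add_comm, ← Nat.mul_succ] at h4

/-- The auxiliary color splits the classes. -/
def finishStep (P : ℕ) : Step := fun d _ => { d with cls := P * d.cls + d.psi }

/-- The scale of the auxiliary coloring that is legal on classes with out-degree bound `β`. -/
def finalScale (β : ℕ) : ℕ := Nat.log 2 (32 * max β 1) + 1

/-- A legal coloring of classes with out-degree bound `β`. -/
noncomputable def finalProg (L β : ℕ) : List Step :=
  layerProg β L ++ (refineProg (finalScale β) L ++ [finishStep (scalePrime (finalScale β) ^ 2)])

theorem run_finalProg {V : Type*} [Fintype V] {G : SimpleGraph V} {x : V → VertexData}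
    (hx : Function.Injective fun v => (x v).id) {L β M : ℕ}
    (hV : Fintype.card V < 2 ^ L) (hid : ∀ v, (x v).id < 2 ^ L)
    (hβ : OutDegreeBound G (fun v => (x v).cls) β) (hM : ∀ v, (x v).cls < M) :
    (∀ v, (run G (finalProg L β) x v).cls < (128 * max β 1) ^ 2 * M) ∧
    ∀ u v, G.Adj u v → (run G (finalProg L β) x u).cls ≠ (run G (finalProg L β) x v).cls := by
  classical
  set j := finalScale β with hj
  -- The conflicts of a vertex times 2^j are at most 8 · 4β = 32β, so beyond this scale there are
  -- none.
  have hlt : 32 * max β 1 < 2 ^ j := Nat.lt_pow_succ_log_self (by norm_num) _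
  have hle : 2 ^ j ≤ 64 * max β 1 := by
    have h1 := Nat.pow_log_le_self 2 (x := 32 * max β 1) (by have := le_max_right β 1; omega)
    rw [hj, finalScale, pow_succ]
    omega
  have hj2 : 2 ≤ j := by
    by_contra hlt2
    have : 2 ^ j ≤ 2 ^ 1 := Nat.pow_le_pow_right (by norm_num) (by omega)
    have := le_max_right β 1
    omega
  set P := scalePrime j ^ 2 with hP
  have hPle : P ≤ (128 * max β 1) ^ 2 := by
    refine Nat.pow_le_pow_left ((scalePrime_le j).trans ?_) 2
    rw [pow_succ]
    omega
  set y := run G (layerProg β L) x with hy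
  obtain ⟨hyx, hylay⟩ := run_layerProg hx hβ hV
  rw [← hy] at hyx hylay
  have hyid : Function.Injective fun v => (y v).id := by
    simpa only [fun v => (hyx v).1] using hx
  set z := run G (refineProg j L) y with hz
  obtain ⟨hzy, hzdef⟩ := run_refineProg hj2 hyid hylay
    fun v => by rw [(hyx v).1]; exact hid v
  rw [← hz, ← hP] at hzdef
  rw [← hz] at hzy
  have hzid : Function.Injective fun v => (z v).id := by
    simpa only [fun v => (hzy v).1] using hyid
  have hrun : run G (finalProg L β) x = runStep G (finishStep P) z := by
    simp only [finalProg, run_append, run_cons, run_nil, hz, hy, hP, hj]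
  rw [hrun]
  refine ⟨fun v => (mul_add_lt (hzdef v).1 (M := M) ?_).trans_le (Nat.mul_le_mul_right M hPle),
    fun u v huv heq => ?_⟩
  · rw [(hzy v).2.1, (hyx v).2]
    exact hM v
  · obtain ⟨h1, h2⟩ := mul_add_inj (hzdef u).1 (hzdef v).1 heq
    have hno : ∀ u v, G.Adj u v → (z u).psi = (z v).psi → ¬ IsAbove (z v) (z u) := by
      intro u v huv hpsi hab
      have h3 := (hzdef v).2
      have h4 : 0 < (Finset.univ.filter fun u => G.Adj v u ∧ IsAbove (z v) (z u) ∧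
          (z u).psi = (z v).psi).card :=
        Finset.card_pos.2 ⟨u, by simpa using ⟨huv.symm, hab, hpsi⟩⟩
      have h5 := Nat.mul_le_mul_right (2 ^ j) (Nat.succ_le_of_lt h4)
      have := le_max_left β 1
      omega
    have hne : (z u).id ≠ (z v).id := fun h => G.ne_of_adj huv (hzid h)
    have huv' := hno u v huv h2
    have hvu' := hno v u huv.symm h2.symm
    unfold IsAbove at huv' hvu'
    omega

theorem length_layerProg (β L : ℕ) : (layerProg β L).length = L + 1 := by
  simp [layerProg]

theorem length_refineProg_le (j L : ℕ) : (refineProg j L).length ≤ L + 2 := by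
  have h : ∀ i, (refineRounds j i).length = i := fun i => by
    induction i with
    | zero => rfl
    | succ i ih => simp [refineRounds, ih]
  simp only [refineProg, List.length_cons, h]
  omega

theorem length_phases_le (m L r β : ℕ) :
    (phases m L r β).length ≤ r * ((L + 1) * (phasePalette m + 4)) := by
  have h : ∀ Q k i, (greedyRounds Q k i).length = i := fun Q k i => by
    induction i with
    | zero => rfl
    | succ i ih => simp [greedyRounds, ih]
  induction r generalizing β with
  | zero => simp [phases]
  | succ r ih =>
    have h1 := ih (β / 2 ^ (m - 3))
    have h2 := length_refineProg_le (m + 3) L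
    simp only [phases, phaseProg, List.length_append, length_layerProg, h, List.length_singleton]
    rw [add_mul r, one_mul, mul_add (L + 1)]
    rw [mul_add (L + 1)] at h1
    omega

theorem length_finalProg_le (L β : ℕ) : (finalProg L β).length ≤ (L + 1) * 4 := by
  have h2 := length_refineProg_le (finalScale β) L
  simp only [finalProg, List.length_append, length_layerProg, List.length_singleton]
  omega

end Phases

/-! ### Choice of parameters and the final count -/

section Main

/-- The whole program: `r a` phases followed by a legal coloring of the classes. -/
noncomputable def coloringProg (m : ℕ) (r : ℕ → ℕ) (n a : ℕ) : List Step :=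
  if n ≤ 1 then []
  else phases m (Nat.log 2 n + 1) (r a) a ++
    finalProg (Nat.log 2 n + 1) (a / 2 ^ ((m - 3) * r a))

theorem run_coloringProg {V : Type*} [Fintype V] {G : SimpleGraph V} {ident : V → ℕ} {m a : ℕ}
    (r : ℕ → ℕ) (hm : 3 ≤ m) (hinj : Function.Injective ident)
    (hid : ∀ v, ident v ∈ Finset.Icc 1 (Fintype.card V)) (ha : arboricity G ≤ a) :
    (∀ v, (run G (coloringProg m r (Fintype.card V) a) (initialData ident) v).cls <
      (128 * max (a / 2 ^ ((m - 3) * r a)) 1) ^ 2 * 2 ^ (m * r a)) ∧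
    ∀ u v, G.Adj u v → (run G (coloringProg m r (Fintype.card V) a) (initialData ident) u).cls ≠
      (run G (coloringProg m r (Fintype.card V) a) (initialData ident) v).cls := by
  unfold coloringProg
  split_ifs with hn
  · refine ⟨fun v => ?_, fun u v huv => ?_⟩
    · have := le_max_right (a / 2 ^ ((m - 3) * r a)) 1
      exact Nat.mul_pos (pow_pos (by omega) 2) (by positivity)
    · have := Fintype.card_le_one_iff_subsingleton.1 hn
      exact absurd (Subsingleton.elim u v) huv.ne
  · have hV : Fintype.card V < 2 ^ (Nat.log 2 (Fintype.card V) + 1) :=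
      Nat.lt_pow_succ_log_self (by norm_num) _
    have hx : Function.Injective fun v => (initialData ident v).id := hinj
    have hlt : ∀ v, (initialData ident v).id < 2 ^ (Nat.log 2 (Fintype.card V) + 1) :=
      fun v => (Finset.mem_Icc.1 (hid v)).2.trans_lt hV
    obtain ⟨h1, h2⟩ := run_phases hm hV (r a) hx hlt (OutDegreeBound.of_arboricity_le ha _)
      (M := 1) fun v => Nat.zero_lt_one
    have h3 := run_finalProg (by simpa only [fun v => (h1 v).1] using hx) hV
      (fun v => by rw [(h1 v).1]; exact hlt v) h2 fun v => (h1 v).2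
    simpa only [run_append, mul_one] using h3

theorem length_coloringProg_le (m : ℕ) (r : ℕ → ℕ) (n a : ℕ) :
    ((coloringProg m r n a).length : ℝ) ≤
      (r a + 1) * (3 * Real.logb 2 n * (phasePalette m + 4)) := by
  unfold coloringProg
  split_ifs with hn
  -- Here log n = 0, so only the empty program meets the bound.
  · have : n = 0 ∨ n = 1 := by omega
    rcases this with rfl | rfl <;> simp
  · have h1 := length_phases_le m (Nat.log 2 n + 1) (r a) a
    have h2 := length_finalProg_le (Nat.log 2 n + 1) (a / 2 ^ ((m - 3) * r a))
    have h3 : (Nat.log 2 n + 1 + 1) * 4 ≤ (Nat.log 2 n + 1 + 1) * (phasePalette m + 4) :=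
      Nat.mul_le_mul_left _ (by omega)
    have h4 : (phases m (Nat.log 2 n + 1) (r a) a ++
        finalProg (Nat.log 2 n + 1) (a / 2 ^ ((m - 3) * r a))).length ≤
        (r a + 1) * ((Nat.log 2 n + 1 + 1) * (phasePalette m + 4)) := by
      rw [List.length_append, add_mul (r a), one_mul]
      omega
    have h5 : (Nat.log 2 n : ℝ) ≤ Real.logb 2 n := by
      exact_mod_cast Real.natLog_le_logb n 2
    have h6 : 1 ≤ Real.logb 2 n := by
      have : (1 : ℝ) ≤ (Nat.log 2 n : ℝ) := by
        exact_mod_cast Nat.log_pos (by norm_num) (by omega)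
      exact this.trans h5
    calc (((phases m (Nat.log 2 n + 1) (r a) a ++
        finalProg (Nat.log 2 n + 1) (a / 2 ^ ((m - 3) * r a))).length : ℕ) : ℝ)
        ≤ (((r a + 1) * ((Nat.log 2 n + 1 + 1) * (phasePalette m + 4)) : ℕ) : ℝ) := by
          exact_mod_cast h4
      _ = (r a + 1) * (((Nat.log 2 n : ℝ) + 1 + 1) * (phasePalette m + 4)) := by push_cast; ring
      _ ≤ _ := by gcongr; linarith

/-- This lets a multiple of log g(a) absorb the additive cost of the final coloring: g(a) ≥ 2 for
large `a`, and only finitely many `a` remain. -/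
theorem exists_pos_le_logb {g : ℕ → ℝ} (hg : Tendsto g atTop atTop) :
    ∃ c > 0, ∀ a, 1 < g a → c ≤ Real.logb 2 (g a) := by
  have hfin : ∀ N : ℕ, ∃ c > 0, ∀ a < N, 1 < g a → c ≤ Real.logb 2 (g a) := by
    intro N
    induction N with
    | zero => exact ⟨1, one_pos, fun a ha => absurd ha (Nat.not_lt_zero a)⟩
    | succ N ih =>
      obtain ⟨c, hc, h⟩ := ih
      by_cases hN : 1 < g N
      · refine ⟨min c (Real.logb 2 (g N)), lt_min hc (Real.logb_pos (by norm_num) hN),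
          fun a ha h1 => ?_⟩
        rcases Nat.lt_succ_iff_lt_or_eq.1 ha with h2 | rfl
        · exact (min_le_left _ _).trans (h a h2 h1)
        · exact min_le_right _ _
      · refine ⟨c, hc, fun a ha h1 => ?_⟩
        rcases Nat.lt_succ_iff_lt_or_eq.1 ha with h2 | rfl
        · exact h a h2 h1
        · exact absurd h1 hN
  obtain ⟨N, hN⟩ := eventually_atTop.1 (hg.eventually_ge_atTop 2)
  obtain ⟨c, hc, h⟩ := hfin N
  refine ⟨min c 1, lt_min hc one_pos, fun a h1 => ?_⟩
  rcases lt_or_ge a N with ha | ha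
  · exact (min_le_left _ _).trans (h a ha h1)
  · refine (min_le_right _ _).trans ?_
    rw [Real.le_logb_iff_rpow_le (by norm_num) (by linarith), Real.rpow_one]
    exact hN a ha

/-- The number of phases: each of them divides the number of colors by `2 ^ e`. -/
noncomputable def phaseCount (e : ℕ) (g : ℕ → ℝ) (a : ℕ) : ℕ := ⌊Real.logb 2 (g a) / e⌋₊

theorem pow_phaseCount_le {e : ℕ} (he : 0 < e) {g : ℕ → ℝ} {a : ℕ} (hg : 1 < g a) :
    (2 : ℝ) ^ (e * phaseCount e g a) ≤ g a := by
  have he' : (0 : ℝ) < e := by exact_mod_cast he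
  have h0 := Real.logb_pos (b := 2) (by norm_num) hg
  have h1 : (phaseCount e g a : ℝ) ≤ Real.logb 2 (g a) / e := Nat.floor_le (by positivity)
  rw [le_div_iff₀ he', Real.le_logb_iff_rpow_le (by norm_num) (by linarith)] at h1
  rw [← Real.rpow_natCast]
  push_cast
  rwa [mul_comm]

theorem lt_pow_phaseCount {e : ℕ} (he : 0 < e) {g : ℕ → ℝ} {a : ℕ} (hg : 1 < g a) :
    g a < 2 ^ e * (2 : ℝ) ^ (e * phaseCount e g a) := by
  have he' : (0 : ℝ) < e := by exact_mod_cast he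
  have h1 : Real.logb 2 (g a) / e < (phaseCount e g a : ℝ) + 1 := Nat.lt_floor_add_one _
  rw [div_lt_iff₀ he', Real.logb_lt_iff_lt_rpow (by norm_num) (by linarith)] at h1
  rw [← pow_add, ← Real.rpow_natCast]
  push_cast
  convert h1 using 2
  ring

/-- The power is at most g(a)^((e+3)/e), and the hypothesis on η says exactly that (1-η)(e+3)/e ≤ 1.
Thus the out-degree bound before the final coloring can be replaced by at least 1 at constant cost.
-/
theorem pow_phaseCount_le_mul {e : ℕ} (he : 0 < e) {g : ℕ → ℝ} {a : ℕ} (ha : 1 ≤ a)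
    (hg : 1 < g a) {η K : ℝ} (hK : 0 ≤ K) (hη : 3 ≤ η * (e + 3))
    (hgK : g a ≤ K * (a : ℝ) ^ (1 - η)) :
    (2 : ℝ) ^ ((e + 3) * phaseCount e g a) ≤ K ^ (((e : ℝ) + 3) / e) * a := by
  have he' : (0 : ℝ) < e := by exact_mod_cast he
  have ha' : (1 : ℝ) ≤ a := by exact_mod_cast ha
  have hs : 0 ≤ ((e : ℝ) + 3) / e := by positivity
  calc (2 : ℝ) ^ ((e + 3) * phaseCount e g a)
      = ((2 : ℝ) ^ (e * phaseCount e g a)) ^ (((e : ℝ) + 3) / e) := by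
        rw [← Real.rpow_natCast, ← Real.rpow_natCast, ← Real.rpow_mul (by norm_num)]
        congr 1
        push_cast
        field_simp
    _ ≤ (K * (a : ℝ) ^ (1 - η)) ^ (((e : ℝ) + 3) / e) :=
        Real.rpow_le_rpow (by positivity) ((pow_phaseCount_le he hg).trans hgK) hs
    _ = K ^ (((e : ℝ) + 3) / e) * (a : ℝ) ^ ((1 - η) * (((e : ℝ) + 3) / e)) := by
        rw [Real.mul_rpow hK (by positivity), ← Real.rpow_mul (by positivity)]
    _ ≤ K ^ (((e : ℝ) + 3) / e) * (a : ℝ) ^ (1 : ℝ) := by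
        refine mul_le_mul_of_nonneg_left (Real.rpow_le_rpow_of_exponent_le ha' ?_)
          (Real.rpow_nonneg hK _)
        rw [mul_div_assoc', div_le_one he']
        linarith
    _ = _ := by rw [Real.rpow_one]

theorem colorCount_le {e : ℕ} (he : 0 < e) {g : ℕ → ℝ} {a : ℕ} (hg : 1 < g a) {B : ℝ}
    (hB : 1 ≤ B) (ha : (2 : ℝ) ^ ((e + 3) * phaseCount e g a) ≤ B * a) :
    (((128 * max (a / 2 ^ ((e + 3) * phaseCount e g a)) 1) ^ 2 *
      2 ^ ((e + 6) * phaseCount e g a) : ℕ) : ℝ) ≤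
      128 ^ 2 * B ^ 2 * 2 ^ e * ((a : ℝ) ^ 2 / g a) := by
  have hgt := lt_pow_phaseCount he hg
  set r := phaseCount e g a
  set X : ℝ := (2 : ℝ) ^ ((e + 3) * r) with hX
  set Y : ℝ := (2 : ℝ) ^ (e * r) with hY
  have hX0 : 0 < X := by positivity
  have hY0 : 0 < Y := by positivity
  have hmax : ((max (a / 2 ^ ((e + 3) * r)) 1 : ℕ) : ℝ) ≤ B * a / X := by
    rw [Nat.cast_max, Nat.cast_one]
    refine max_le ?_ ((one_le_div hX0).2 ha)
    refine (Nat.cast_div_le (α := ℝ)).trans ?_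
    push_cast
    rw [← hX]
    gcongr
    exact le_mul_of_one_le_left (Nat.cast_nonneg a) hB
  -- The exponents balance: 2(e + 3) = (e + 6) + e. The surplus `Y` is the saving, within a factor
  -- 2^e of g(a).
  have hXY : X ^ 2 = (2 : ℝ) ^ ((e + 6) * r) * Y := by
    rw [hX, hY, ← pow_mul, ← pow_add]
    congr 1
    ring
  calc (((128 * max (a / 2 ^ ((e + 3) * r)) 1) ^ 2 * 2 ^ ((e + 6) * r) : ℕ) : ℝ)
      = (128 * ((max (a / 2 ^ ((e + 3) * r)) 1 : ℕ) : ℝ)) ^ 2 * 2 ^ ((e + 6) * r) := by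
        push_cast; ring
    _ ≤ (128 * (B * a / X)) ^ 2 * 2 ^ ((e + 6) * r) := by gcongr
    _ = 128 ^ 2 * B ^ 2 * ((a : ℝ) ^ 2 / Y) := by
        rw [mul_pow, div_pow, hXY]
        field_simp
    _ ≤ 128 ^ 2 * B ^ 2 * (2 ^ e * ((a : ℝ) ^ 2 / g a)) := by
        refine mul_le_mul_of_nonneg_left ?_ (by positivity)
        rw [div_le_iff₀ hY0, mul_assoc, div_mul_eq_mul_div, mul_div_assoc', le_div_iff₀ (by linarith)]
        have := mul_le_mul_of_nonneg_left hgt.le (sq_nonneg (a : ℝ))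
        linarith
    _ = _ := by ring

end Main

theorem mainTheorem7 (η : ℝ) (hη : 0 < η) (g : ℕ → ℝ)
    (hg_omega : Tendsto g atTop atTop)
    (hg_bigO : g =O[atTop] fun a : ℕ => (a : ℝ) ^ (1 - η)) :
    ∃ (A : LocalAlgorithm) (C : ℝ), 0 < C ∧
      ∀ a : ℕ, 1 ≤ a → 1 < g a →
        ∀ (V : Type*) [Fintype V] (G : SimpleGraph V) (ident : V → ℕ),
          Function.Injective ident → (∀ v, ident v ∈ Finset.Icc 1 (Fintype.card V)) →
          arboricity G ≤ a →
            ∃ k T : ℕ,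
              (k : ℝ) ≤ C * ((a : ℝ) ^ 2 / g a) ∧
              (T : ℝ) ≤ C * (Real.logb 2 (g a) * Real.logb 2 (Fintype.card V)) ∧
              A.ColorsWithin G ident a k T := by
  obtain ⟨K₀, hK₀, hbound⟩ := bound_of_isBigO_nat_atTop hg_bigO
  obtain ⟨c, hc, hlog⟩ := exists_pos_le_logb hg_omega
  -- At least 1, so that `B` is too.
  set K := max K₀ 1
  have hgK : ∀ a : ℕ, 1 ≤ a → 1 < g a → g a ≤ K * (a : ℝ) ^ (1 - η) := by
    intro a ha hga
    have ha0 : (0 : ℝ) < (a : ℝ) ^ (1 - η) :=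
      Real.rpow_pos_of_pos (by exact_mod_cast ha) _
    have h := hbound ha0.ne'
    rw [Real.norm_of_nonneg (by linarith), Real.norm_of_nonneg ha0.le] at h
    exact h.trans (mul_le_mul_of_nonneg_right (le_max_left _ _) ha0.le)
  obtain ⟨e, he, heη⟩ : ∃ e : ℕ, 0 < e ∧ 3 ≤ η * (e + 3) := by
    refine ⟨⌈3 / η⌉₊, Nat.ceil_pos.2 (by positivity), ?_⟩
    have h1 := Nat.le_ceil (3 / η)
    rw [div_le_iff₀ hη] at h1
    linarith
  set B := K ^ (((e : ℝ) + 3) / e)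
  have hB : 1 ≤ B := Real.one_le_rpow (le_max_right _ _) (by positivity)
  set C₁ : ℝ := 128 ^ 2 * B ^ 2 * 2 ^ e
  set C₂ : ℝ := (1 + 1 / c) * (3 * (phasePalette (e + 6) + 4))
  have hC₁ : 0 < C₁ := by positivity
  have hC₂ : 0 < C₂ := by positivity
  refine ⟨programAlgorithm (coloringProg (e + 6) (phaseCount e g)), C₁ + C₂, by positivity, ?_⟩
  intro a ha hga V _ G ident hinj hid harb
  obtain ⟨hlt, hne⟩ := run_coloringProg (m := e + 6) (phaseCount e g) (by omega) hinj hid harb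
  refine ⟨_, _, ?_, ?_, colorsWithin_programAlgorithm _ G ident a _ hlt hne⟩
  · refine (colorCount_le he hga hB (pow_phaseCount_le_mul he ha hga
      (zero_le_one.trans (le_max_right _ _)) heη (hgK a ha hga))).trans ?_
    refine mul_le_mul_of_nonneg_right (le_add_of_nonneg_right hC₂.le) (by positivity)
  · refine (length_coloringProg_le _ _ _ _).trans ?_
    have hl0 := Real.logb_pos (b := 2) (by norm_num) hga
    have hn0 : 0 ≤ Real.logb 2 (Fintype.card V : ℝ) := by
      exact_mod_cast (Nat.cast_nonneg (Nat.log 2 (Fintype.card V))).trans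
        (Real.natLog_le_logb (Fintype.card V) 2)
    have he1 : (1 : ℝ) ≤ e := by exact_mod_cast he
    have hr : (phaseCount e g a : ℝ) + 1 ≤ (1 + 1 / c) * Real.logb 2 (g a) := by
      have h1 : (phaseCount e g a : ℝ) ≤ Real.logb 2 (g a) :=
        (Nat.floor_le (by positivity)).trans (div_le_self hl0.le he1)
      have h2 : 1 ≤ 1 / c * Real.logb 2 (g a) := by
        rw [one_div_mul_eq_div, one_le_div hc]
        exact hlog a hga
      linarith
    calc ((phaseCount e g a : ℝ) + 1) *
          (3 * Real.logb 2 (Fintype.card V) * (phasePalette (e + 6) + 4))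
        ≤ (1 + 1 / c) * Real.logb 2 (g a) *
          (3 * Real.logb 2 (Fintype.card V) * (phasePalette (e + 6) + 4)) := by gcongr
      _ = C₂ * (Real.logb 2 (g a) * Real.logb 2 (Fintype.card V)) := by ring
      _ ≤ _ := by gcongr; linarith
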